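/- All rings are commutative, Noetherian and local, with identity. A local homomorphism $g:(A,\mathfrak a)\to(B,\mathfrak b)$ is said to be of finite length if the ideal $g(\mathfrak a)B$ is $\mathfrak b$-primary. For an endomorphism $\varphi$ of finite length of $(R,\mathfrak m)$, with $\varphi^n$ its $n$-fold composition, the local entropy of $\varphi$ is $$h_{\mathrm{loc}}(\varphi)=\lim_{n\to\infty}\frac1n\log\operatorname{length}_R\bigl(R/\varphi^n(\mathfrak m)R\bigr).$$ Theorem. Let $(R,\mathfrak m)$ and $(S,\mathfrak n)$ be Noetherian local rings, let $\varphi:R\to R$ and $\psi:S\to S$ be endomorphisms of finite length, and let $f:R\to S$ be a flat local homomorphism with $\psi\circ f=f\circ\varphi$. Let $\overline\psi$ be the endomorphism of the closed fiber $S/f(\mathfrak m)S$ induced by $\psi$. If $S$ is Cohen–Macaulay, then $\overline\psi$ is of finite length, the limits defining $h_{\mathrm{loc}}(\varphi)$, $h_{\mathrm{loc}}(\psi)$ and $h_{\mathrm{loc}}(\overline\psi)$ exist as real numbers, and $$h_{\mathrm{loc}}(\psi)=h_{\mathrm{loc}}(\varphi)+h_{\mathrm{loc}}(\overline\psi).$$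 -/

import Mathlib

open Filter Topology

universe u v

namespace LocalDyn

open IsLocalRing

/-- A ring homomorphism `f : (R, 𝔪) → (S, 𝔫)` of local rings is *of finite length* if it is local
and the extended ideal `f(𝔪)S` is `𝔫`-primary. -/
structure IsFiniteLengthHom {R : Type u} {S : Type v} [CommRing R] [IsLocalRing R]
    [CommRing S] [IsLocalRing S] (f : R →+* S) : Prop where
  isLocalHom : IsLocalHom f
  isPrimary : ((maximalIdeal R).map f).IsPrimary
  radical_eq : ((maximalIdeal R).map f).radical = maximalIdeal S

/-- The sequence `(1/n) log (length_R (R / φⁿ(𝔪)R))`, where `φⁿ` is the `n`-fold composition. -/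
noncomputable def entropySeq {R : Type u} [CommRing R] [IsLocalRing R] (φ : R →+* R) (n : ℕ) : ℝ :=
  (1 / (n : ℝ)) *
    Real.log ((Module.length R (R ⧸ (maximalIdeal R).map (φ ^ n))).toNat : ℝ)

/-- The local entropy `h_loc(φ)`: the limit of `(1/n) log (length_R (R / φⁿ(𝔪)R))`. -/
noncomputable def localEntropy {R : Type u} [CommRing R] [IsLocalRing R] (φ : R →+* R) : ℝ :=
  limUnder atTop (entropySeq φ)

/-- The depth of a local ring: the supremum of the lengths of the regular sequences
in its maximal ideal. -/
noncomputable def depth (S : Type u) [CommRing S] [IsLocalRing S] : ℕ∞ :=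
  sSup {d : ℕ∞ | ∃ rs : List S, (∀ r ∈ rs, r ∈ maximalIdeal S) ∧
    RingTheory.Sequence.IsRegular S rs ∧ d = rs.length}

/-- A (Noetherian) local ring is Cohen–Macaulay if its depth equals its Krull dimension. -/
def IsCohenMacaulay (S : Type u) [CommRing S] [IsLocalRing S] : Prop :=
  (depth S : WithBot ℕ∞) = ringKrullDim S

section ClosedFiber

variable {R : Type u} {S : Type v} [CommRing R] [IsLocalRing R] [CommRing S]

theorem map_maximalIdeal_le [IsLocalRing S] (f : R →+* S) [IsLocalHom f] :
    (maximalIdeal R).map f ≤ maximalIdeal S :=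
  ((local_hom_TFAE f).out 0 2).mp ‹IsLocalHom f›

/-- The closed fiber `S / f(𝔪)S` of `f : (R, 𝔪) → S`. -/
abbrev ClosedFiber (f : R →+* S) : Type v := S ⧸ (maximalIdeal R).map f

instance closedFiber_isLocalRing [IsLocalRing S] (f : R →+* S) [IsLocalHom f] :
    IsLocalRing (ClosedFiber f) :=
  haveI : Nontrivial (ClosedFiber f) :=
    Ideal.Quotient.nontrivial_iff.mpr fun h =>
      (maximalIdeal.isMaximal S).ne_top (top_le_iff.mp (h ▸ map_maximalIdeal_le f))
  IsLocalRing.of_surjective' (Ideal.Quotient.mk _) Ideal.Quotient.mk_surjective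

/-- `f(𝔪)S` is `ψ`-stable whenever `ψ ∘ f = f ∘ φ` with `φ` local. -/
theorem map_maximalIdeal_le_comap {f : R →+* S} {φ : R →+* R} {ψ : S →+* S} (hφ : IsLocalHom φ)
    (hcomm : ψ.comp f = f.comp φ) :
    (maximalIdeal R).map f ≤ ((maximalIdeal R).map f).comap ψ := by
  rw [← Ideal.map_le_iff_le_comap, Ideal.map_map, hcomm, ← Ideal.map_map]
  exact Ideal.map_mono (map_maximalIdeal_le φ)

/-- The endomorphism of the closed fiber `S / f(𝔪)S` induced by `ψ`. -/
def inducedEnd {f : R →+* S} {φ : R →+* R} {ψ : S →+* S} (hφ : IsLocalHom φ)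
    (hcomm : ψ.comp f = f.comp φ) : ClosedFiber f →+* ClosedFiber f :=
  Ideal.quotientMap _ ψ (map_maximalIdeal_le_comap hφ hcomm)

end ClosedFiber

end LocalDyn

/-! Write ℓ for length, 𝔪ₙ = φⁿ(𝔪)R and 𝔫ₙ = ψⁿ(𝔫)S. The n-th length for the closed fiber is ℓ(S/(𝔪S
+ 𝔫ₙ)). Since (1/n) log kills constant factors, it suffices that ℓ(S/𝔫ₙ) and ℓ(R/𝔪ₙ)·ℓ(S/(𝔪S + 𝔫ₙ))
agree up to a factor independent of n. The limits exist by subadditivity.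

The bound ≤ needs no flatness: filter R/𝔪ₙ by copies of the residue field (`length_pow_le_mul`).

For the other bound, let x be a system of parameters of R, and let y lift one of the closed fiber.
By flatness x, y is a system of parameters of S (`exists_parameters_of_flat`). So is its image under
ψⁿ, which is therefore a regular sequence because S is Cohen–Macaulay (`IsCohenMacaulay.regularOn`).
Thus ψⁿ(y) is regular on S/φⁿ(x)S, which is flat over the Artinian ring R/φⁿ(x)R; dividing by ψⁿ(y)
preserves flatness (`ColonCompatible.ofList`), and lengths multiply: ℓ(R/φⁿ(x)R)·ℓ(S/(𝔪S + ψⁿ(y)S))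
≤ ℓ(S/ψⁿ(x, y)S) ≤ ℓ(S/(x, y)S)·ℓ(S/𝔫ₙ). The left side dominates ℓ(R/𝔪ₙ)·ℓ(S/(𝔪S + 𝔫ₙ)), so the
constant is ℓ(S/(x, y)S). -/

namespace LocalDyn

open IsLocalRing

/-! ### Lengths of quotients and induction along socle elements -/

section Length

variable {A : Type u} [CommRing A]

theorem length_quotient_eq_add {J K : Ideal A} {c : A} (hK : ∀ x, x ∈ K ↔ c * x ∈ J) :
    Module.length A (A ⧸ J) =
      Module.length A (A ⧸ (J ⊔ Ideal.span {c})) + Module.length A (A ⧸ K) := by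
  have hJ : J ≤ J ⊔ Ideal.span {c} := le_sup_left
  have hKle : K ≤ Submodule.comap (LinearMap.mulLeft A c) J := fun x hx => by simpa using (hK x).mp hx
  rw [add_comm]
  refine Module.length_eq_add_of_exact
    (Submodule.mapQ K J (LinearMap.mulLeft A c) hKle) (Submodule.factor hJ)
    ?_ (Submodule.factor_surjective hJ) ?_
  · rw [← LinearMap.ker_eq_bot, LinearMap.ker_eq_bot']
    intro x hx
    obtain ⟨x, rfl⟩ := Submodule.Quotient.mk_surjective _ x
    rw [Submodule.mapQ_apply, Submodule.Quotient.mk_eq_zero] at hx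
    exact (Submodule.Quotient.mk_eq_zero _).mpr ((hK x).mpr (by simpa using hx))
  · intro x
    obtain ⟨x, rfl⟩ := Submodule.Quotient.mk_surjective _ x
    constructor
    · intro hx
      have hx : x ∈ J ⊔ Ideal.span {c} := (Submodule.Quotient.mk_eq_zero _).mp hx
      obtain ⟨j, hj, d, hd, rfl⟩ := Submodule.mem_sup.mp hx
      obtain ⟨t, rfl⟩ := Ideal.mem_span_singleton'.mp hd
      refine ⟨Submodule.Quotient.mk t, ?_⟩
      rw [Submodule.mapQ_apply, Submodule.Quotient.eq]
      simpa [mul_comm] using hj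
    · rintro ⟨t, ht⟩
      obtain ⟨t, rfl⟩ := Submodule.Quotient.mk_surjective _ t
      rw [← ht, Submodule.mapQ_apply]
      refine (Submodule.Quotient.mk_eq_zero _).mpr ?_
      exact Submodule.mem_sup_right (Ideal.mem_span_singleton'.mpr ⟨t, by simp [mul_comm]⟩)

theorem length_quotient_anti {I J : Ideal A} (h : I ≤ J) :
    Module.length A (A ⧸ J) ≤ Module.length A (A ⧸ I) :=
  Module.length_le_of_surjective (Submodule.factor h) (Submodule.factor_surjective h)

theorem length_quotient_pos {I : Ideal A} (h : I ≠ ⊤) : 0 < Module.length A (A ⧸ I) :=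
  haveI := Ideal.Quotient.nontrivial_iff.mpr h
  Module.length_pos

theorem length_quotient_top : Module.length A (A ⧸ (⊤ : Ideal A)) = 0 :=
  haveI : Subsingleton (A ⧸ (⊤ : Ideal A)) := Ideal.Quotient.subsingleton_iff.mpr rfl
  Module.length_eq_zero

variable [IsLocalRing A]

theorem length_quotient_maximalIdeal : Module.length A (A ⧸ maximalIdeal A) = 1 := by
  rw [Module.length_eq_one_iff]
  exact isSimpleModule_iff_isCoatom.mpr (maximalIdeal.isMaximal A).out

theorem exists_notMem_maximalIdeal_mul_mem {I : Ideal A} (hI : I ≠ ⊤) {N : ℕ}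
    (hN : maximalIdeal A ^ N ≤ I) : ∃ c ∉ I, ∀ a ∈ maximalIdeal A, a * c ∈ I := by
  classical
  have hex : ∃ N, maximalIdeal A ^ N ≤ I := ⟨N, hN⟩
  have h0 : Nat.find hex ≠ 0 := fun h => hI <| by
    have := Nat.find_spec hex
    rwa [h, pow_zero, Ideal.one_eq_top, top_le_iff] at this
  obtain ⟨k, hk⟩ := Nat.exists_eq_succ_of_ne_zero h0
  obtain ⟨c, hc, hcI⟩ := SetLike.not_le_iff_exists.mp
    (Nat.find_min hex (m := k) (by omega))
  refine ⟨c, hcI, fun a ha => Nat.find_spec hex ?_⟩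
  rw [hk, pow_succ']
  exact Ideal.mul_mem_mul ha hc

theorem mem_maximalIdeal_iff_mul_mem {I : Ideal A} {c : A} (hc : c ∉ I)
    (h : ∀ a ∈ maximalIdeal A, a * c ∈ I) (x : A) : x ∈ maximalIdeal A ↔ c * x ∈ I := by
  refine ⟨fun hx => mul_comm c x ▸ h x hx, fun hx => ?_⟩
  by_contra hxm
  have hu : IsUnit x := by simpa using hxm
  exact hc ((Ideal.mul_unit_mem_iff_mem I hu).mp hx)

variable [IsNoetherianRing A]

/-- Adjoining a socle element of A/I enlarges I by one copy of the residue field. Noetherian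
induction on such steps plays the role of a composition series of A/I. -/
theorem primaryIdeal_induction {P : Ideal A → Prop} (top : P ⊤)
    (step : ∀ (I : Ideal A) (N : ℕ) (c : A), maximalIdeal A ^ N ≤ I → c ∉ I →
      (∀ a ∈ maximalIdeal A, a * c ∈ I) → P (I ⊔ Ideal.span {c}) → P I)
    {I : Ideal A} {N : ℕ} (hN : maximalIdeal A ^ N ≤ I) : P I := by
  induction I using WellFoundedGT.induction with
  | ind I ih =>
    by_cases hI : I = ⊤
    · rwa [hI]
    obtain ⟨c, hc, hmc⟩ := exists_notMem_maximalIdeal_mul_mem hI hN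
    refine step I N c hN hc hmc (ih _ ?_ (hN.trans le_sup_left))
    refine lt_of_le_of_ne le_sup_left fun h => hc ?_
    rw [h]
    exact Submodule.mem_sup_right (Ideal.mem_span_singleton_self c)

theorem length_quotient_ne_top {I : Ideal A} {N : ℕ} (hN : maximalIdeal A ^ N ≤ I) :
    Module.length A (A ⧸ I) ≠ ⊤ := by
  refine primaryIdeal_induction (P := fun I => Module.length A (A ⧸ I) ≠ ⊤) ?_ ?_ hN
  · rw [length_quotient_top]; exact ENat.zero_ne_top
  · intro I N c _ hc hmc ih
    rw [length_quotient_eq_add (mem_maximalIdeal_iff_mul_mem hc hmc), length_quotient_maximalIdeal]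
    exact WithTop.add_ne_top.mpr ⟨ih, ENat.one_ne_top⟩

/-- Modulo IB + K, the element g(c) is killed by 𝔪B + K, so each socle step of A/I contributes at
most one copy of B/(𝔪B + K). -/
theorem length_quotient_map_sup_le {B : Type v} [CommRing B] (g : A →+* B) (K : Ideal B)
    {I : Ideal A} {N : ℕ} (hN : maximalIdeal A ^ N ≤ I) :
    Module.length B (B ⧸ (I.map g ⊔ K)) ≤
      Module.length A (A ⧸ I) * Module.length B (B ⧸ ((maximalIdeal A).map g ⊔ K)) := by
  refine primaryIdeal_induction (P := fun I => Module.length B (B ⧸ (I.map g ⊔ K)) ≤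
      Module.length A (A ⧸ I) * Module.length B (B ⧸ ((maximalIdeal A).map g ⊔ K))) ?_ ?_ hN
  · rw [Ideal.map_top, top_sup_eq, length_quotient_top, length_quotient_top, zero_mul]
  · intro I N c _ hc hmc ih
    have hK : ∀ x, x ∈ Submodule.comap (LinearMap.mulLeft B (g c)) (I.map g ⊔ K) ↔
        g c * x ∈ I.map g ⊔ K := fun x => by simp
    rw [length_quotient_eq_add (mem_maximalIdeal_iff_mul_mem hc hmc),
      length_quotient_maximalIdeal, length_quotient_eq_add hK, add_mul, one_mul]
    refine add_le_add ?_ (length_quotient_anti ?_)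
    · rwa [Ideal.map_sup, Ideal.map_span, Set.image_singleton, sup_right_comm] at ih
    · refine sup_le (Ideal.map_le_iff_le_comap.mpr fun a ha => ?_) fun x hx => ?_
      · refine (hK _).mpr (Submodule.mem_sup_left ?_)
        rw [← map_mul, mul_comm]
        exact Ideal.mem_map_of_mem g (hmc a ha)
      · exact (hK _).mpr (Submodule.mem_sup_right (Ideal.mul_mem_left _ _ hx))

end Length

/-! ### Regular sequences modulo an ideal -/

section RegularOn

variable {S : Type v} [CommRing S]

/-- The list `l` is a (weakly) regular sequence on `S / J`. -/
def RegularOn : Ideal S → List S → Prop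
  | _, [] => True
  | J, a :: l => (∀ x, a * x ∈ J → x ∈ J) ∧ RegularOn (J ⊔ Ideal.span {a}) l

theorem RegularOn.of_append {J : Ideal S} {l l' : List S} (h : RegularOn J (l ++ l')) :
    RegularOn (J ⊔ Ideal.ofList l) l' := by
  induction l generalizing J with
  | nil => simpa using h
  | cons a l ih => simpa [sup_assoc] using ih h.2

theorem regularOn_of_isWeaklyRegular {l l' : List S}
    (h : RingTheory.Sequence.IsWeaklyRegular S (l ++ l')) : RegularOn (Ideal.ofList l) l' := by
  induction l' generalizing l with
  | nil => trivial
  | cons a l' ih =>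
    refine ⟨fun x hx => ?_, ?_⟩
    · have hreg := h.regular_mod_prev l.length (by simp)
      have htake : Ideal.ofList ((l ++ a :: l').take l.length) • (⊤ : Submodule S S) =
          Ideal.ofList l := by rw [List.take_left, smul_eq_mul, Ideal.mul_top]
      rw [htake] at hreg
      simp only [List.getElem_append_right le_rfl, Nat.sub_self,
        List.getElem_cons_zero] at hreg
      have := isSMulRegular_iff_right_eq_zero_of_smul.mp hreg
        (Submodule.Quotient.mk x) ?_
      · exact (Submodule.Quotient.mk_eq_zero _).mp this
      · rw [← Submodule.Quotient.mk_smul]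
        exact (Submodule.Quotient.mk_eq_zero _).mpr hx
    · have := @ih (l ++ [a]) (by simpa using h)
      simpa using this

end RegularOn

/-! ### Flatness over Artinian quotients, expressed through colon ideals -/

section Flat

variable {R : Type u} {S : Type v} [CommRing R] [CommRing S] {f : R →+* S}

/-- The equational criterion of flatness, applied to -c·s + Σ rₖ·iₖ = 0 with rₖ ∈ I, writes s with
coefficients a satisfying c·a ∈ I. -/
theorem mem_map_algebraMap_of_flat [Algebra R S] [Module.Flat R S] {I K : Ideal R} {c : R}
    (hK : ∀ x, c * x ∈ I → x ∈ K) {s : S} (hs : algebraMap R S c * s ∈ I.map (algebraMap R S)) :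
    s ∈ K.map (algebraMap R S) := by
  obtain ⟨n, i, t, hsum⟩ :=
    (Submodule.mem_span_set' (R := S) (s := algebraMap R S '' (I : Set R))).mp hs
  choose r hr hfr using fun k => (t k).2
  -- The index `none` carries the term -c·s.
  have hrel : ∑ k : Option (Fin n), (k.elim (-c) r) • (k.elim s i) = 0 := by
    rw [Fintype.sum_option]
    simp only [Option.elim, Algebra.smul_def, map_neg, neg_mul, ← hsum, hfr]
    simp [mul_comm]
  obtain ⟨k, a, y, hy, ha⟩ := Module.Flat.isTrivialRelation_of_sum_smul_eq_zero
    (R := R) (M := S) (f := fun k : Option (Fin n) => k.elim (-c) r) (x := fun k => k.elim s i) hrel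
  have hys : s = ∑ j, a none j • y j := hy none
  rw [hys]
  refine Ideal.sum_mem _ fun j _ => ?_
  rw [Algebra.smul_def]
  refine Ideal.mul_mem_right _ _ (Ideal.mem_map_of_mem _ (hK _ ?_))
  have haj : ∑ i : Option (Fin n), i.elim (-c) r * a i j = 0 := ha j
  rw [Fintype.sum_option, Option.elim_none, neg_mul, neg_add_eq_zero] at haj
  rw [haj]
  exact Ideal.sum_mem _ fun x _ => Ideal.mul_mem_right _ _ (hr x)

theorem mem_map_of_flat (hf : f.Flat) {I K : Ideal R} {c : R} (hK : ∀ x, c * x ∈ I → x ∈ K)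
    {s : S} (hs : f c * s ∈ I.map f) : s ∈ K.map f := by
  algebraize [f]
  exact mem_map_algebraMap_of_flat hK hs

/-- `S / Y` behaves like a flat module over `R` for the quotients of `R / I`. -/
def ColonCompatible (f : R →+* S) (I : Ideal R) (Y : Ideal S) : Prop :=
  ∀ (I' K : Ideal R) (c : R), I ≤ I' → (∀ x, c * x ∈ I' → x ∈ K) →
    ∀ s, f c * s ∈ I'.map f ⊔ Y → s ∈ K.map f ⊔ Y

theorem mul_map_sup_mem {I K : Ideal R} {c : R} {Y : Ideal S} (hK : ∀ x ∈ K, c * x ∈ I) {s : S}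
    (hs : s ∈ K.map f ⊔ Y) : f c * s ∈ I.map f ⊔ Y := by
  have : K.map f ⊔ Y ≤ Submodule.comap (LinearMap.mulLeft S (f c)) (I.map f ⊔ Y) := by
    refine sup_le (Ideal.map_le_iff_le_comap.mpr fun a ha => ?_) fun x hx => ?_
    · refine Submodule.mem_sup_left ?_
      rw [LinearMap.mulLeft_apply, ← map_mul]
      exact Ideal.mem_map_of_mem f (hK a ha)
    · exact Submodule.mem_sup_right (Ideal.mul_mem_left _ _ hx)
  exact this hs

theorem map_sup_span_singleton_sup (I : Ideal R) (c : R) (Y : Ideal S) :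
    (I ⊔ Ideal.span {c}).map f ⊔ Y = (I.map f ⊔ Y) ⊔ Ideal.span {f c} := by
  rw [Ideal.map_sup, Ideal.map_span, Set.image_singleton, sup_right_comm]

theorem mem_sup_span_singleton_iff {J : Ideal S} {a s : S} :
    s ∈ J ⊔ Ideal.span {a} ↔ ∃ j ∈ J, ∃ t, s = j + a * t := by
  rw [Submodule.mem_sup]
  constructor
  · rintro ⟨j, hj, d, hd, rfl⟩
    obtain ⟨t, rfl⟩ := Ideal.mem_span_singleton'.mp hd
    exact ⟨j, hj, t, by ring⟩
  · rintro ⟨j, hj, t, rfl⟩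
    exact ⟨j, hj, a * t, Ideal.mem_span_singleton'.mpr ⟨t, mul_comm _ _⟩, rfl⟩

variable [IsLocalRing R] [IsNoetherianRing R]

/-- Multiplication by a socle element of R/I embeds S/(𝔪S + Y) into S/(IS + Y), so y is regular on
the former. Every S/(I'S + Y) is an iterated extension of copies of it, so y is regular there too.
-/
theorem ColonCompatible.mul_mem_imp_mem {I : Ideal R} {Y : Ideal S} (h : ColonCompatible f I Y)
    {N : ℕ} (hN : maximalIdeal R ^ N ≤ I) {y : S}
    (hy : ∀ x, y * x ∈ I.map f ⊔ Y → x ∈ I.map f ⊔ Y) {I' : Ideal R} (hI' : I ≤ I') (s : S)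
    (hs : y * s ∈ I'.map f ⊔ Y) : s ∈ I'.map f ⊔ Y := by
  by_cases hI : I = ⊤
  · have : I' = ⊤ := top_le_iff.mp (hI ▸ hI')
    simp [this, Ideal.map_top]
  have key : ∀ s, y * s ∈ (maximalIdeal R).map f ⊔ Y → s ∈ (maximalIdeal R).map f ⊔ Y := by
    intro s hs
    obtain ⟨c, hcI, hmc⟩ := exists_notMem_maximalIdeal_mul_mem hI hN
    have hc := mem_maximalIdeal_iff_mul_mem hcI hmc
    refine h I _ c le_rfl (fun x hx => (hc x).mpr hx) s (hy _ ?_)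
    have := mul_map_sup_mem (fun x hx => (hc x).mp hx) hs
    rwa [mul_left_comm] at this
  refine primaryIdeal_induction (P := fun I' => I ≤ I' → ∀ s, y * s ∈ I'.map f ⊔ Y →
    s ∈ I'.map f ⊔ Y) ?_ ?_ (hN.trans hI') hI' s hs
  · intro _ s _
    simp [Ideal.map_top]
  · intro J N c _ hc hmc ih hJ s hs
    have h1 := ih (hJ.trans le_sup_left) s
    rw [map_sup_span_singleton_sup] at h1
    obtain ⟨j, hj, t, rfl⟩ := mem_sup_span_singleton_iff.mp (h1 (Submodule.mem_sup_left hs))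
    have h2 : f c * (y * t) ∈ J.map f ⊔ Y := by
      have := Ideal.sub_mem _ hs (Ideal.mul_mem_left _ y hj)
      convert! this using 1
      ring
    have h3 := h J (maximalIdeal R) c hJ
      (fun x hx => (mem_maximalIdeal_iff_mul_mem hc hmc x).mpr hx) _ h2
    refine Ideal.add_mem _ hj (mul_map_sup_mem ?_ (key _ h3))
    exact fun x hx => (mem_maximalIdeal_iff_mul_mem hc hmc x).mp hx

theorem ColonCompatible.sup_span_singleton {I : Ideal R} {Y : Ideal S}
    (h : ColonCompatible f I Y) {N : ℕ} (hN : maximalIdeal R ^ N ≤ I) {y : S}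
    (hy : ∀ x, y * x ∈ I.map f ⊔ Y → x ∈ I.map f ⊔ Y) :
    ColonCompatible f I (Y ⊔ Ideal.span {y}) := by
  intro I' K c hI' hK s hs
  rw [← sup_assoc, mem_sup_span_singleton_iff] at hs
  obtain ⟨e, he, t, hst⟩ := hs
  have h1 : t ∈ (I' ⊔ Ideal.span {c}).map f ⊔ Y := by
    refine h.mul_mem_imp_mem hN hy (hI'.trans le_sup_left) t ?_
    rw [map_sup_span_singleton_sup, mem_sup_span_singleton_iff]
    exact ⟨-e, neg_mem he, s, by linear_combination -hst⟩
  rw [map_sup_span_singleton_sup, mem_sup_span_singleton_iff] at h1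
  obtain ⟨e', he', t', rfl⟩ := h1
  rw [← sup_assoc, mem_sup_span_singleton_iff]
  refine ⟨s - y * t', h I' K c hI' hK _ ?_, t', by ring⟩
  have := Ideal.add_mem _ he (Ideal.mul_mem_left _ y he')
  convert! this using 1
  linear_combination hst

theorem ColonCompatible.ofList {I : Ideal R} {Y : Ideal S} (h : ColonCompatible f I Y) {N : ℕ}
    (hN : maximalIdeal R ^ N ≤ I) {l : List S} (hl : RegularOn (I.map f ⊔ Y) l) :
    ColonCompatible f I (Y ⊔ Ideal.ofList l) := by
  induction l generalizing Y with
  | nil => simpa using h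
  | cons y l ih =>
    rw [Ideal.ofList_cons, ← sup_assoc]
    refine ih (h.sup_span_singleton hN hl.1) ?_
    rw [← sup_assoc]
    exact hl.2

/-- The colon condition makes each socle step contribute exactly one copy of S/(𝔪S + Y). -/
theorem le_length_quotient_map_sup {I : Ideal R} {Y : Ideal S} (h : ColonCompatible f I Y) {N : ℕ}
    (hN : maximalIdeal R ^ N ≤ I) :
    Module.length R (R ⧸ I) * Module.length S (S ⧸ ((maximalIdeal R).map f ⊔ Y)) ≤
      Module.length S (S ⧸ (I.map f ⊔ Y)) := by
  refine primaryIdeal_induction (P := fun I' => I ≤ I' → Module.length R (R ⧸ I') *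
    Module.length S (S ⧸ ((maximalIdeal R).map f ⊔ Y)) ≤
      Module.length S (S ⧸ (I'.map f ⊔ Y))) ?_ ?_ hN le_rfl
  · intro _
    rw [length_quotient_top, zero_mul]
    exact zero_le
  · intro J N c _ hc hmc ih hJ
    have hmem := mem_maximalIdeal_iff_mul_mem hc hmc
    have hK : ∀ s, s ∈ (maximalIdeal R).map f ⊔ Y ↔ f c * s ∈ J.map f ⊔ Y := fun s =>
      ⟨mul_map_sup_mem fun x hx => (hmem x).mp hx,
        h J _ c hJ (fun x hx => (hmem x).mpr hx) s⟩
    rw [length_quotient_eq_add hmem, length_quotient_maximalIdeal, length_quotient_eq_add hK,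
      add_mul, one_mul, ← map_sup_span_singleton_sup]
    exact add_le_add (ih (hJ.trans le_sup_left)) le_rfl

theorem le_length_quotient_of_flat (hf : f.Flat) {I : Ideal R} {N : ℕ}
    (hN : maximalIdeal R ^ N ≤ I) {l : List S} (hl : RegularOn (I.map f) l) :
    Module.length R (R ⧸ I) * Module.length S (S ⧸ ((maximalIdeal R).map f ⊔ Ideal.ofList l)) ≤
      Module.length S (S ⧸ (I.map f ⊔ Ideal.ofList l)) := by
  have h0 : ColonCompatible f I (⊥ : Ideal S) := by
    intro I' K c _ hK s hs
    rw [sup_bot_eq] at hs ⊢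
    exact mem_map_of_flat hf hK hs
  have := h0.ofList hN (by rwa [sup_bot_eq])
  rw [bot_sup_eq] at this
  exact le_length_quotient_map_sup this hN

end Flat

/-! ### Systems of parameters in Cohen–Macaulay rings -/

section

section Radical

variable {A : Type u} [CommRing A] [IsLocalRing A]

theorem maximalIdeal_le_radical_of_mem_minimalPrimes {I : Ideal A}
    (h : maximalIdeal A ∈ I.minimalPrimes) : maximalIdeal A ≤ I.radical := by
  rw [Ideal.radical_eq_sInf]
  refine le_sInf fun J hJ => h.2 ⟨hJ.2, hJ.1⟩ ?_
  have := hJ.2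
  exact le_maximalIdeal_of_isPrime J

theorem maximalIdeal_mem_minimalPrimes {I : Ideal A} (hI : I ≤ maximalIdeal A)
    (h : maximalIdeal A ≤ I.radical) : maximalIdeal A ∈ I.minimalPrimes :=
  ⟨⟨inferInstance, hI⟩, fun _ hJ _ => h.trans (hJ.1.radical_le_iff.mpr hJ.2)⟩

end Radical

variable {S : Type v} [CommRing S] [IsNoetherianRing S]

section AssociatedPrimes

theorem exists_mem_associatedPrimes {J : Ideal S} {u : S} (hu : u ∉ J) :
    ∃ p ∈ associatedPrimes S (S ⧸ J), ∀ x, x * u ∈ J → x ∈ p := by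
  obtain ⟨p, hp, hle⟩ := exists_le_isAssociatedPrime_of_isNoetherianRing S
    (Submodule.Quotient.mk (p := J) u) (fun h => hu ((Submodule.Quotient.mk_eq_zero J).mp h))
  refine ⟨p, hp, fun x hx => hle (Submodule.mem_colon_singleton.mpr ?_)⟩
  rw [← Submodule.Quotient.mk_smul]
  exact (Submodule.Quotient.mk_eq_zero J).mpr hx

theorem exists_of_mem_associatedPrimes {J p : Ideal S} (hp : p ∈ associatedPrimes S (S ⧸ J)) :
    ∃ u ∉ J, ∀ x, x ∈ p ↔ x * u ∈ J := by
  obtain ⟨hprime, u, rfl⟩ := isAssociatedPrime_iff.mp hp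
  obtain ⟨u, rfl⟩ := Submodule.Quotient.mk_surjective _ u
  have h : ∀ x, x ∈ (⊥ : Submodule S (S ⧸ J)).colon {Submodule.Quotient.mk u} ↔ x * u ∈ J := by
    intro x
    rw [Submodule.mem_colon_singleton, ← Submodule.Quotient.mk_smul]
    exact Submodule.Quotient.mk_eq_zero J
  refine ⟨u, fun hu => hprime.ne_top ((Ideal.eq_top_iff_one _).mpr ((h 1).mpr ?_)), h⟩
  rwa [one_mul]

theorem exists_mem_associatedPrimes_of_mul_mem {J : Ideal S} {a u : S} (hu : u ∉ J)
    (h : a * u ∈ J) : ∃ p ∈ associatedPrimes S (S ⧸ J), a ∈ p :=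
  let ⟨p, hp, hle⟩ := exists_mem_associatedPrimes hu
  ⟨p, hp, hle a h⟩

end AssociatedPrimes

variable [IsLocalRing S]

/-- Let N = (J : p). If N ⊆ J + (a), regularity of a gives N ⊆ J + aN, so N ⊆ J by Nakayama,
contradicting that p is associated. Hence some v ∈ N survives modulo J + (a), and its annihilator
there contains p and a ∉ p. -/
theorem exists_lt_associatedPrime {J p : Ideal S} {a : S} (ha : ∀ x, a * x ∈ J → x ∈ J)
    (ham : a ∈ maximalIdeal S) (hp : p ∈ associatedPrimes S (S ⧸ J)) :
    ∃ q ∈ associatedPrimes S (S ⧸ (J ⊔ Ideal.span {a})), p < q := by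
  obtain ⟨u, hu, hpu⟩ := exists_of_mem_associatedPrimes hp
  let N : Ideal S := ⨅ t ∈ p, Submodule.comap (LinearMap.mulLeft S t) J
  have hN : ∀ x, x ∈ N ↔ ∀ t ∈ p, t * x ∈ J := fun x => by simp [N, Submodule.mem_iInf]
  have hnle : ¬ N ≤ J ⊔ Ideal.span {a} := by
    intro hle
    have hNJ : N ≤ J ⊔ maximalIdeal S • N := by
      intro x hx
      obtain ⟨j, hj, t, rfl⟩ := mem_sup_span_singleton_iff.mp (hle hx)
      refine Submodule.add_mem_sup hj (Submodule.smul_mem_smul ham ((hN t).mpr fun r hr => ha _ ?_))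
      have := Ideal.sub_mem _ ((hN _).mp hx r hr) (Ideal.mul_mem_left _ r hj)
      convert! this using 1
      ring
    have := Submodule.le_of_le_smul_of_le_jacobson_bot (IsNoetherian.noetherian N)
      (jacobson_eq_maximalIdeal (⊥ : Ideal S) bot_ne_top).ge hNJ
    exact hu (this ((hN u).mpr fun t ht => (hpu t).mp ht))
  obtain ⟨v, hvN, hv⟩ := SetLike.not_le_iff_exists.mp hnle
  obtain ⟨q, hq, hqv⟩ := exists_mem_associatedPrimes hv
  refine ⟨q, hq, lt_of_le_of_ne
    (fun t ht => hqv t (Submodule.mem_sup_left ((hN v).mp hvN t ht))) fun hpq => ?_⟩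
  have haq : a ∈ q := hqv a (Submodule.mem_sup_right
    (Ideal.mul_mem_right _ _ (Ideal.mem_span_singleton_self a)))
  rw [← hpq, hpu] at haq
  exact hu (ha u haq)

theorem RegularOn.length_le_coheight {J : Ideal S} {l : List S} (hl : RegularOn J l)
    (hm : ∀ a ∈ l, a ∈ maximalIdeal S) {p : PrimeSpectrum S}
    (hp : p.asIdeal ∈ associatedPrimes S (S ⧸ J)) : (l.length : ℕ∞) ≤ Order.coheight p := by
  induction l generalizing J p with
  | nil => simp
  | cons a l ih =>
    obtain ⟨q, hq, hpq⟩ := exists_lt_associatedPrime hl.1 (hm a (by simp)) hp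
    have := @ih _ hl.2 (fun b hb => hm b (by simp [hb])) ⟨q, hq.isPrime⟩ hq
    have hlt : p < ⟨q, hq.isPrime⟩ := hpq
    calc ((a :: l).length : ℕ∞) = l.length + 1 := by simp
      _ ≤ Order.coheight (⟨q, hq.isPrime⟩ : PrimeSpectrum S) + 1 := by gcongr
      _ ≤ Order.coheight p := Order.coheight_add_one_le hlt

/-- Krull's height theorem in the local domain S/p. -/
theorem coheight_le_length {p : PrimeSpectrum S} {l : List S} (hm : ∀ a ∈ l, a ∈ maximalIdeal S)
    (h : maximalIdeal S ≤ (p.asIdeal ⊔ Ideal.ofList l).radical) :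
    Order.coheight p ≤ l.length := by
  classical
  have : Nontrivial (S ⧸ p.asIdeal) := Ideal.Quotient.nontrivial_iff.mpr p.2.ne_top
  have : IsLocalRing (S ⧸ p.asIdeal) :=
    .of_surjective' (Ideal.Quotient.mk p.asIdeal) Ideal.Quotient.mk_surjective
  have hloc : IsLocalHom (Ideal.Quotient.mk p.asIdeal) :=
    Ideal.Quotient.mk_surjective.isLocalHom
  have hmap : (maximalIdeal S).map (Ideal.Quotient.mk p.asIdeal) = maximalIdeal (S ⧸ p.asIdeal) :=
    map_maximalIdeal_of_surjective _ Ideal.Quotient.mk_surjective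
  let s : Finset (S ⧸ p.asIdeal) := (l.map (Ideal.Quotient.mk p.asIdeal)).toFinset
  have hs : Ideal.span (s : Set (S ⧸ p.asIdeal)) =
      (Ideal.ofList l).map (Ideal.Quotient.mk p.asIdeal) := by
    rw [Ideal.map_ofList]
    congr 1
    ext x
    simp [s]
  have hmin : maximalIdeal (S ⧸ p.asIdeal) ∈ (Ideal.span (s : Set (S ⧸ p.asIdeal))).minimalPrimes := by
    rw [hs]
    refine maximalIdeal_mem_minimalPrimes ?_ ?_
    · rw [← hmap]
      exact Ideal.map_mono (Ideal.span_le.mpr hm)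
    · rw [← hmap]
      refine (Ideal.map_mono h).trans ((Ideal.map_radical_le _).trans (Ideal.radical_mono ?_))
      rw [Ideal.map_sup, Ideal.map_quotient_self, bot_sup_eq]
  have hcard : s.card ≤ l.length := by
    simpa [s] using List.toFinset_card_le (l.map (Ideal.Quotient.mk p.asIdeal))
  have h1 := Ideal.height_le_card_of_mem_minimalPrimes_span_finset hmin
  have h2 : (Order.coheight p : WithBot ℕ∞) = (maximalIdeal (S ⧸ p.asIdeal)).height := by
    rw [maximalIdeal_height_eq_ringKrullDim, ringKrullDim_quotient, Order.coheight_eq_krullDim_Ici]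
    rfl
  rw [WithBot.coe_inj.mp h2]
  exact h1.trans (by exact_mod_cast hcard)

omit [IsNoetherianRing S] [IsLocalRing S] in
theorem regular_mod_swap {J : Ideal S} {a w : S} (ha : ∀ x, a * x ∈ J → x ∈ J)
    (hw : ∀ x, w * x ∈ J ⊔ Ideal.span {a} → x ∈ J ⊔ Ideal.span {a}) (x : S)
    (hx : a * x ∈ J ⊔ Ideal.span {w}) : x ∈ J ⊔ Ideal.span {w} := by
  obtain ⟨j, hj, t, ht⟩ := mem_sup_span_singleton_iff.mp hx
  obtain ⟨j', hj', t', rfl⟩ := mem_sup_span_singleton_iff.mp (hw t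
    (mem_sup_span_singleton_iff.mpr ⟨-j, neg_mem hj, x, by linear_combination -ht⟩))
  refine mem_sup_span_singleton_iff.mpr ⟨x - w * t', ha _ ?_, t', by ring⟩
  have := Ideal.add_mem _ hj (Ideal.mul_mem_left _ w hj')
  convert! this using 1
  linear_combination ht

/-- By `h` each S/J i has zero socle, so 𝔪 lies in none of the finitely many associated primes;
prime avoidance supplies w. -/
theorem exists_mem_maximalIdeal_regular_mod {ι : Type*} [Finite ι] (J : ι → Ideal S)
    (h : ∀ i u, (∀ t ∈ maximalIdeal S, t * u ∈ J i) → u ∈ J i) :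
    ∃ w ∈ maximalIdeal S, ∀ i x, w * x ∈ J i → x ∈ J i := by
  by_contra! hcon
  have hfin : (⋃ i, associatedPrimes S (S ⧸ J i)).Finite :=
    Set.finite_iUnion fun i => associatedPrimes.finite S (S ⧸ J i)
  obtain ⟨p, hp, hle⟩ := ((maximalIdeal S).subset_union_prime_finite hfin (f := id) 0 0
    (fun q hq _ _ => (Set.mem_iUnion.mp hq).choose_spec.isPrime)).1 <| by
      intro w hw
      obtain ⟨i, x, hx, hxJ⟩ := hcon w hw
      obtain ⟨p, hp, hwp⟩ := exists_mem_associatedPrimes_of_mul_mem hxJ hx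
      exact Set.mem_biUnion (Set.mem_iUnion.mpr ⟨i, hp⟩) hwp
  obtain ⟨i, hp⟩ := Set.mem_iUnion.mp hp
  obtain ⟨u, hu, hpu⟩ := exists_of_mem_associatedPrimes hp
  exact hu (h i u fun t ht => (hpu t).mp (hle ht))

/-- An exchange argument: an auxiliary w, regular modulo J, J + (a) and J + (z), permits replacing a
by w and then w by z. -/
theorem RegularOn.exists_sup_span_singleton {D : ℕ} {J : Ideal S} {l : List S}
    (hl : RegularOn J l) (hlm : ∀ a ∈ l, a ∈ maximalIdeal S) (hD : l.length = D + 1) {z : S}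
    (hzm : z ∈ maximalIdeal S) (hz : ∀ x, z * x ∈ J → x ∈ J) :
    ∃ l' : List S, l'.length = D ∧ (∀ a ∈ l', a ∈ maximalIdeal S) ∧
      RegularOn (J ⊔ Ideal.span {z}) l' := by
  induction D generalizing J l z with
  | zero => exact ⟨[], rfl, by simp, trivial⟩
  | succ D ih =>
    obtain ⟨a, b, l, rfl⟩ : ∃ a b l', l = a :: b :: l' := by
      match l, hD with
      | a :: b :: l', _ => exact ⟨a, b, l', rfl⟩
    obtain ⟨ha, hb, hl⟩ := hl
    have ham : a ∈ maximalIdeal S := hlm a (by simp)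
    have hbm : b ∈ maximalIdeal S := hlm b (by simp)
    have hJa : ∀ u, (∀ t ∈ maximalIdeal S, t * u ∈ J ⊔ Ideal.span {a}) →
        u ∈ J ⊔ Ideal.span {a} := fun u hu => hb u (hu b hbm)
    -- By hand: for a and z regular on M = S/J, the socles of M/zM and M/aM correspond, via a·u ≡
    -- z·v, so both vanish.
    have hJz : ∀ u, (∀ t ∈ maximalIdeal S, t * u ∈ J ⊔ Ideal.span {z}) →
        u ∈ J ⊔ Ideal.span {z} := by
      intro u hu
      obtain ⟨j, hj, v, hv⟩ := mem_sup_span_singleton_iff.mp (hu a ham)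
      have hvJ : v ∈ J ⊔ Ideal.span {a} := by
        refine hJa v fun t ht => ?_
        obtain ⟨j', hj', s, hs⟩ := mem_sup_span_singleton_iff.mp (hu t ht)
        refine mem_sup_span_singleton_iff.mpr ⟨t * v - a * s, hz _ ?_, s, by ring⟩
        have := Ideal.sub_mem _ (Ideal.mul_mem_left _ a hj') (Ideal.mul_mem_left _ t hj)
        convert! this using 1
        linear_combination a * hs - t * hv
      obtain ⟨j', hj', v', rfl⟩ := mem_sup_span_singleton_iff.mp hvJ
      refine mem_sup_span_singleton_iff.mpr ⟨u - z * v', ha _ ?_, v', by ring⟩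
      have := Ideal.add_mem _ hj (Ideal.mul_mem_left _ z hj')
      convert! this using 1
      linear_combination hv
    obtain ⟨w, hwm, hw⟩ := exists_mem_maximalIdeal_regular_mod
      ![J, J ⊔ Ideal.span {a}, J ⊔ Ideal.span {z}] (by
        intro i
        fin_cases i
        · exact fun u hu => ha u (hu a ham)
        · exact hJa
        · exact hJz)
    obtain ⟨l₁, hl₁, hl₁m, hreg₁⟩ := ih (J := J ⊔ Ideal.span {a}) (l := b :: l) ⟨hb, hl⟩
      (fun c hc => hlm c (List.mem_cons_of_mem _ hc)) (by simpa using hD) hwm (hw 1)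
    -- Since a and w can be swapped, a :: l₁ is regular modulo J + (w), and z is regular there as
    -- well.
    obtain ⟨l₂, hl₂, hl₂m, hreg₂⟩ := ih (J := J ⊔ Ideal.span {w}) (l := a :: l₁)
      ⟨regular_mod_swap ha (hw 1), by rwa [sup_right_comm]⟩
      (by simpa using ⟨ham, hl₁m⟩) (by simp [hl₁]) hzm (regular_mod_swap hz (hw 2))
    exact ⟨w :: l₂, by simp [hl₂], by simpa using ⟨hwm, hl₂m⟩, hw 2, by rwa [sup_right_comm]⟩

/-- If b were a zero divisor modulo J, it would lie in an associated prime p. The sequence l forces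
coheight p ≥ |l|, while the remaining parameters allow at most |l| - 1. The exchange lemma then
continues modulo b. -/
theorem RegularOn.of_maximalIdeal_le_radical {J : Ideal S} {l z : List S} (hl : RegularOn J l)
    (hlm : ∀ a ∈ l, a ∈ maximalIdeal S) (hlen : z.length = l.length)
    (hzm : ∀ a ∈ z, a ∈ maximalIdeal S)
    (hz : maximalIdeal S ≤ (J ⊔ Ideal.ofList z).radical) : RegularOn J z := by
  induction z generalizing J l with
  | nil => trivial
  | cons b z ih =>
    have hbm : b ∈ maximalIdeal S := hzm b (by simp)
    have hzm' : ∀ a ∈ z, a ∈ maximalIdeal S := fun a ha => hzm a (List.mem_cons_of_mem _ ha)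
    rw [Ideal.ofList_cons, ← sup_assoc] at hz
    have hb : ∀ x, b * x ∈ J → x ∈ J := by
      intro x hx
      by_contra hxJ
      obtain ⟨p, hp, hbp⟩ := exists_mem_associatedPrimes_of_mul_mem hxJ hx
      have h1 := hl.length_le_coheight hlm (p := ⟨p, hp.isPrime⟩) hp
      obtain ⟨u, _, hpu⟩ := exists_of_mem_associatedPrimes hp
      have h2 : Order.coheight (⟨p, hp.isPrime⟩ : PrimeSpectrum S) ≤ z.length := by
        refine coheight_le_length hzm' (hz.trans (Ideal.radical_mono (sup_le_sup_right ?_ _)))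
        refine sup_le (fun j hj => (hpu j).mpr (Ideal.mul_mem_right _ _ hj)) ?_
        exact (Ideal.span_singleton_le_iff_mem _).mpr hbp
      have h3 := h1.trans h2
      rw [← hlen] at h3
      norm_cast at h3
      simp at h3
    obtain ⟨l', hl', hlm', hreg⟩ :=
      hl.exists_sup_span_singleton (D := z.length) hlm (by rw [← hlen]; rfl) hbm hb
    exact ⟨hb, ih hreg hlm' hl'.symm hzm' hz⟩

theorem IsCohenMacaulay.regularOn (hS : IsCohenMacaulay S) {z : List S}
    (hlen : (z.length : WithBot ℕ∞) = ringKrullDim S) (hzm : ∀ a ∈ z, a ∈ maximalIdeal S)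
    (hz : maximalIdeal S ≤ (Ideal.ofList z).radical) : RegularOn ⊥ z := by
  have hdepth : depth S = z.length := by
    have : (depth S : WithBot ℕ∞) = ((z.length : ℕ∞) : WithBot ℕ∞) := by
      rw [hS, ← hlen]; rfl
    exact WithBot.coe_inj.mp this
  have hne : Nonempty {d : ℕ∞ | ∃ rs : List S, (∀ r ∈ rs, r ∈ maximalIdeal S) ∧
      RingTheory.Sequence.IsRegular S rs ∧ d = rs.length} :=
    ⟨0, [], by simp, RingTheory.Sequence.IsRegular.nil S S, by simp⟩
  -- The depth is finite, so its supremum is attained by an actual regular sequence.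
  obtain ⟨rs, hrs, hreg, hd⟩ := ENat.sSup_mem_of_nonempty_of_lt_top (hs' := by
    change depth S < ⊤
    rw [hdepth]; exact ENat.natCast_lt_top _)
  change depth S = rs.length at hd
  rw [hdepth] at hd
  have hreg' : RegularOn ⊥ rs := by
    simpa using regularOn_of_isWeaklyRegular (l := []) (l' := rs) hreg.toIsWeaklyRegular
  exact hreg'.of_maximalIdeal_le_radical hrs (by exact_mod_cast hd) hzm (by rwa [bot_sup_eq])

end

section

/-! ### Limits of normalized logarithms -/

section Limits

/-- Fekete's lemma for log a. -/
theorem exists_tendsto_of_submultiplicative {a : ℕ → ℕ} (hpos : ∀ n, 0 < a n)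
    (hmul : ∀ m n, a (m + n) ≤ a m * a n) :
    ∃ L, Tendsto (fun n : ℕ => 1 / (n : ℝ) * Real.log (a n)) atTop (𝓝 L) := by
  have hsub : Subadditive fun n => Real.log (a n) := by
    intro m n
    have hm : (a m : ℝ) ≠ 0 := by exact_mod_cast (hpos m).ne'
    have hn : (a n : ℝ) ≠ 0 := by exact_mod_cast (hpos n).ne'
    rw [← Real.log_mul hm hn]
    exact Real.log_le_log (by exact_mod_cast hpos _) (by exact_mod_cast hmul m n)
  have hbdd : BddBelow (Set.range fun n : ℕ => Real.log (a n) / n) := by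
    refine ⟨0, ?_⟩
    rintro _ ⟨n, rfl⟩
    exact div_nonneg (Real.log_natCast_nonneg _) n.cast_nonneg
  refine ⟨hsub.lim, (hsub.tendsto_lim hbdd).congr fun n => ?_⟩
  rw [one_div, inv_mul_eq_div]

theorem limit_eq_add_of_le_mul {a b c : ℕ → ℕ} (ha : ∀ n, 0 < a n) (hb : ∀ n, 0 < b n)
    (hc : ∀ n, 0 < c n) {C : ℕ} (hle : ∀ n, c n ≤ a n * b n) (hge : ∀ n, a n * b n ≤ C * c n)
    {La Lb Lc : ℝ} (hLa : Tendsto (fun n : ℕ => 1 / (n : ℝ) * Real.log (a n)) atTop (𝓝 La))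
    (hLb : Tendsto (fun n : ℕ => 1 / (n : ℝ) * Real.log (b n)) atTop (𝓝 Lb))
    (hLc : Tendsto (fun n : ℕ => 1 / (n : ℝ) * Real.log (c n)) atTop (𝓝 Lc)) :
    Lc = La + Lb := by
  have hC : 0 < C := by
    by_contra h
    have := hge 0
    rw [Nat.eq_zero_of_not_pos h, zero_mul] at this
    exact absurd (Nat.mul_pos (ha 0) (hb 0)) (by omega)
  have hlog : ∀ n, Real.log ((a n * b n : ℕ) : ℝ) = Real.log (a n) + Real.log (b n) := fun n => by
    rw [Nat.cast_mul, Real.log_mul (by exact_mod_cast (ha n).ne') (by exact_mod_cast (hb n).ne')]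
  have h0 : Tendsto (fun n : ℕ => 1 / (n : ℝ)) atTop (𝓝 0) := tendsto_one_div_atTop_nhds_zero_nat
  have hlower : Lc ≤ La + Lb := by
    refine le_of_tendsto_of_tendsto' hLc (hLa.add hLb) fun n => ?_
    rw [← mul_add, ← hlog]
    refine mul_le_mul_of_nonneg_left (Real.log_le_log ?_ ?_) (by positivity)
    · exact_mod_cast hc n
    · exact_mod_cast hle n
  have hupper : La + Lb ≤ 0 * Real.log C + Lc := by
    refine le_of_tendsto_of_tendsto' (hLa.add hLb) ((h0.mul_const _).add hLc) fun n => ?_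
    rw [← mul_add, ← mul_add, ← hlog,
      ← Real.log_mul (by exact_mod_cast hC.ne') (by exact_mod_cast (hc n).ne')]
    refine mul_le_mul_of_nonneg_left (Real.log_le_log ?_ ?_) (by positivity)
    · exact_mod_cast Nat.mul_pos (ha n) (hb n)
    · exact_mod_cast hge n
  linarith

end Limits

/-! ### Iterates of endomorphisms of finite length -/

section FiniteLength

variable {A : Type u} [CommRing A] [IsLocalRing A] [IsNoetherianRing A]

theorem exists_maximalIdeal_pow_le {I : Ideal A} (hI : maximalIdeal A ≤ I.radical) :
    ∃ N, maximalIdeal A ^ N ≤ I :=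
  Ideal.exists_pow_le_of_le_radical_of_fg hI (IsNoetherian.noetherian _)

theorem length_quotient_ne_top_of_le_radical {I : Ideal A} (hI : maximalIdeal A ≤ I.radical) :
    Module.length A (A ⧸ I) ≠ ⊤ :=
  let ⟨_, hN⟩ := exists_maximalIdeal_pow_le hI
  length_quotient_ne_top hN

omit [IsNoetherianRing A] in
theorem isFiniteLengthHom_iff_le_radical {φ : A →+* A} (hloc : IsLocalHom φ) :
    IsFiniteLengthHom φ ↔ maximalIdeal A ≤ ((maximalIdeal A).map φ).radical := by
  refine ⟨fun h => h.radical_eq.ge, fun h => ?_⟩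
  have hrad : ((maximalIdeal A).map φ).radical = maximalIdeal A :=
    le_antisymm ((Ideal.IsPrime.radical_le_iff inferInstance).mpr (map_maximalIdeal_le φ)) h
  exact ⟨hloc, Ideal.isPrimary_of_isMaximal_radical (hrad.symm ▸ maximalIdeal.isMaximal A :), hrad⟩

variable {φ : A →+* A}

omit [IsNoetherianRing A] in
theorem IsFiniteLengthHom.map_pow_le (hφ : IsFiniteLengthHom φ) {I : Ideal A}
    (hI : I ≤ maximalIdeal A) (n : ℕ) : I.map (φ ^ n) ≤ maximalIdeal A := by
  have := hφ.isLocalHom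
  induction n with
  | zero => rwa [pow_zero, RingHom.one_def, Ideal.map_id]
  | succ n ih =>
    rw [pow_succ', RingHom.mul_def, ← Ideal.map_map]
    exact (Ideal.map_mono ih).trans (map_maximalIdeal_le φ)

omit [IsNoetherianRing A] in
theorem IsFiniteLengthHom.le_radical_map_pow (hφ : IsFiniteLengthHom φ) {I : Ideal A}
    (hI : maximalIdeal A ≤ I.radical) (n : ℕ) : maximalIdeal A ≤ (I.map (φ ^ n)).radical := by
  induction n with
  | zero => rwa [pow_zero, RingHom.one_def, Ideal.map_id]
  | succ n ih =>
    rw [pow_succ', RingHom.mul_def, ← Ideal.map_map]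
    refine hφ.radical_eq.ge.trans (Ideal.radical_le_radical_iff.mpr ?_)
    exact (Ideal.map_mono ih).trans (Ideal.map_radical_le φ)

theorem IsFiniteLengthHom.length_ne_top (hφ : IsFiniteLengthHom φ) (n : ℕ) :
    Module.length A (A ⧸ (maximalIdeal A).map (φ ^ n)) ≠ ⊤ :=
  length_quotient_ne_top_of_le_radical (hφ.le_radical_map_pow Ideal.le_radical n)

/-- Finiteness matters here as well as properness, because `toNat` sends ⊤ to 0. -/
theorem IsFiniteLengthHom.length_toNat_pos (hφ : IsFiniteLengthHom φ) (n : ℕ) :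
    0 < (Module.length A (A ⧸ (maximalIdeal A).map (φ ^ n))).toNat := by
  refine Nat.pos_of_ne_zero fun h0 => ?_
  refine ((ENat.toNat_eq_zero.mp h0).resolve_right (hφ.length_ne_top n)).not_gt
    (length_quotient_pos fun h => ?_)
  exact (maximalIdeal.isMaximal A).ne_top (top_le_iff.mp (h ▸ hφ.map_pow_le le_rfl n))

theorem length_quotient_map_le {B : Type v} [CommRing B] (g : A →+* B) {I : Ideal A}
    (hI : maximalIdeal A ≤ I.radical) :
    Module.length B (B ⧸ I.map g) ≤
      Module.length A (A ⧸ I) * Module.length B (B ⧸ (maximalIdeal A).map g) := by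
  obtain ⟨N, hN⟩ := exists_maximalIdeal_pow_le hI
  have := length_quotient_map_sup_le g ⊥ hN
  rwa [sup_bot_eq, sup_bot_eq] at this

theorem IsFiniteLengthHom.exists_tendsto_entropySeq (hφ : IsFiniteLengthHom φ) :
    ∃ L, Tendsto (entropySeq φ) atTop (𝓝 L) := by
  refine exists_tendsto_of_submultiplicative hφ.length_toNat_pos fun m n => ?_
  rw [mul_comm, ← ENat.toNat_mul]
  refine ENat.toNat_le_toNat ?_ (WithTop.mul_ne_top (hφ.length_ne_top n) (hφ.length_ne_top m))
  rw [pow_add, RingHom.mul_def, ← Ideal.map_map]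
  exact length_quotient_map_le (φ ^ m) (hφ.le_radical_map_pow Ideal.le_radical n)

theorem IsFiniteLengthHom.tendsto_entropySeq (hφ : IsFiniteLengthHom φ) :
    Tendsto (entropySeq φ) atTop (𝓝 (localEntropy φ)) :=
  tendsto_nhds_limUnder hφ.exists_tendsto_entropySeq

end FiniteLength

/-! ### Parameters of a flat extension, the closed fiber and the two length bounds -/

variable {R : Type u} {S : Type v} [CommRing R] [IsLocalRing R] [CommRing S] [IsLocalRing S]
  {f : R →+* S} [IsLocalHom f]

theorem map_mk_maximalIdeal_closedFiber : (maximalIdeal S).map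
    (Ideal.Quotient.mk ((maximalIdeal R).map f)) = maximalIdeal (ClosedFiber f) :=
  have : IsLocalHom (Ideal.Quotient.mk ((maximalIdeal R).map f)) :=
    Ideal.Quotient.mk_surjective.isLocalHom
  map_maximalIdeal_of_surjective _ Ideal.Quotient.mk_surjective

theorem exists_parameters_of_flat [IsNoetherianRing R] [IsNoetherianRing S] (hf : f.Flat) :
    ∃ (x : List R) (y : List S), (∀ a ∈ x, a ∈ maximalIdeal R) ∧ (∀ b ∈ y, b ∈ maximalIdeal S) ∧
      maximalIdeal R ≤ (Ideal.ofList x).radical ∧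
      maximalIdeal S ≤ ((Ideal.ofList x).map f ⊔ Ideal.ofList y).radical ∧
      ((x.length + y.length : ℕ) : WithBot ℕ∞) = ringKrullDim S := by
  obtain ⟨s, hs, hscard⟩ :=
    (maximalIdeal R).exists_finset_card_eq_height_of_isNoetherianRing
  obtain ⟨t, ht, htcard⟩ :=
    (maximalIdeal (ClosedFiber f)).exists_finset_card_eq_height_of_isNoetherianRing
  let q : S →+* ClosedFiber f := Ideal.Quotient.mk ((maximalIdeal R).map f)
  have hq : Function.Surjective q := Ideal.Quotient.mk_surjective
  have hx : Ideal.ofList s.toList = Ideal.span (s : Set R) := by simp [Ideal.ofList]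
  have hy : (Ideal.ofList (t.toList.map (Function.surjInv hq))).map q = Ideal.span t := by
    rw [Ideal.map_ofList, List.map_map, Function.comp_surjInv hq, List.map_id]
    simp [Ideal.ofList]
  have hxrad : maximalIdeal R ≤ (Ideal.ofList s.toList).radical := by
    rw [hx]
    exact maximalIdeal_le_radical_of_mem_minimalPrimes hs
  refine ⟨s.toList, t.toList.map (Function.surjInv hq), fun a ha => ?_, fun b hb => ?_, hxrad,
    ?_, ?_⟩
  · exact hs.1.2 (Ideal.subset_span (by simpa using ha))
  · obtain ⟨c, hc, rfl⟩ := List.mem_map.mp hb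
    have hcm : q (Function.surjInv hq c) ∈ maximalIdeal (ClosedFiber f) := by
      rw [Function.surjInv_eq hq]
      exact ht.1.2 (Ideal.subset_span (by simpa using hc))
    rw [mem_maximalIdeal, mem_nonunits_iff] at hcm ⊢
    exact fun hu => hcm (hu.map q)
  · have h1 := maximalIdeal_le_radical_of_mem_minimalPrimes ht
    rw [← map_mk_maximalIdeal_closedFiber, Ideal.map_le_iff_le_comap, ← hy, Ideal.comap_radical,
      Ideal.comap_map_of_surjective q hq] at h1
    refine h1.trans (Ideal.radical_le_radical_iff.mpr
      (sup_le (le_sup_right.trans Ideal.le_radical) ?_))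
    have hker : Ideal.comap q ⊥ = (maximalIdeal R).map f := Ideal.mk_ker
    rw [hker]
    exact (Ideal.map_mono hxrad).trans ((Ideal.map_radical_le f).trans
      (Ideal.radical_mono le_sup_left))
  · rw [← maximalIdeal_height_eq_ringKrullDim, List.length_map, Finset.length_toList,
      Finset.length_toList]
    algebraize [f]
    have : (maximalIdeal S).LiesOver (maximalIdeal R) :=
      have h : (maximalIdeal S).comap f = maximalIdeal R :=
        ((local_hom_TFAE f).out 0 4).mp ‹IsLocalHom f›
      ⟨h.symm⟩
    -- Flat maps have going-down, so dim S is dim R plus the dimension of the closed fiber.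
    have hht := Ideal.height_eq_height_add_of_liesOver_of_hasGoingDown
      (maximalIdeal R) (maximalIdeal S)
    have hmap : (maximalIdeal S).map (Ideal.Quotient.mk ((maximalIdeal R).map (algebraMap R S))) =
      maximalIdeal (ClosedFiber f) := map_mk_maximalIdeal_closedFiber
    rw [hmap, ← hscard, ← htcard] at hht
    rw [hht]
    rfl

section InducedEnd

variable {φ : R →+* R} {ψ : S →+* S} (hφ : IsLocalHom φ) (hcomm : ψ.comp f = f.comp φ)

omit [IsLocalRing S] [IsLocalHom f] in
theorem inducedEnd_pow_comp_mk (n : ℕ) :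
    (inducedEnd hφ hcomm ^ n).comp (Ideal.Quotient.mk ((maximalIdeal R).map f)) =
      (Ideal.Quotient.mk ((maximalIdeal R).map f)).comp (ψ ^ n) := by
  induction n with
  | zero => rfl
  | succ n ih =>
    rw [pow_succ', pow_succ', RingHom.mul_def, RingHom.mul_def, RingHom.comp_assoc, ih]
    rfl

theorem map_inducedEnd_pow (n : ℕ) :
    (maximalIdeal (ClosedFiber f)).map (inducedEnd hφ hcomm ^ n) =
      ((maximalIdeal S).map (ψ ^ n)).map (Ideal.Quotient.mk ((maximalIdeal R).map f)) := by
  rw [← map_mk_maximalIdeal_closedFiber, Ideal.map_map, inducedEnd_pow_comp_mk, Ideal.map_map]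

theorem length_quotient_map_mk {A : Type u} [CommRing A] (I J : Ideal A) :
    Module.length (A ⧸ I) ((A ⧸ I) ⧸ J.map (Ideal.Quotient.mk I)) =
      Module.length A (A ⧸ (I ⊔ J)) := by
  rw [← Module.length_eq_of_surjective (S := A) (R := A ⧸ I) Ideal.Quotient.mk_surjective]
  exact (DoubleQuot.quotQuotEquivQuotSupₐ A I J).toLinearEquiv.length_eq

theorem length_inducedEnd_pow (n : ℕ) :
    Module.length (ClosedFiber f)
        (ClosedFiber f ⧸ (maximalIdeal (ClosedFiber f)).map (inducedEnd hφ hcomm ^ n)) =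
      Module.length S (S ⧸ ((maximalIdeal R).map f ⊔ (maximalIdeal S).map (ψ ^ n))) := by
  rw [map_inducedEnd_pow, length_quotient_map_mk]

theorem isLocalHom_inducedEnd (hψ : IsFiniteLengthHom ψ) :
    IsLocalHom (inducedEnd hφ hcomm) := by
  refine ((local_hom_TFAE _).out 0 2).mpr ?_
  have := map_inducedEnd_pow hφ hcomm 1
  rw [pow_one, pow_one] at this
  have hloc := hψ.isLocalHom
  rw [this, ← map_mk_maximalIdeal_closedFiber]
  exact Ideal.map_mono (map_maximalIdeal_le ψ)

theorem isFiniteLengthHom_inducedEnd (hψ : IsFiniteLengthHom ψ) :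
    IsFiniteLengthHom (inducedEnd hφ hcomm) := by
  refine (isFiniteLengthHom_iff_le_radical (isLocalHom_inducedEnd hφ hcomm hψ)).mpr ?_
  have := map_inducedEnd_pow hφ hcomm 1
  rw [pow_one, pow_one] at this
  rw [this, ← map_mk_maximalIdeal_closedFiber]
  exact (Ideal.map_mono hψ.radical_eq.ge).trans (Ideal.map_radical_le _)

omit [IsLocalRing R] [IsLocalRing S] [IsLocalHom f] in
theorem pow_comp_eq_comp_pow (hcomm : ψ.comp f = f.comp φ) (n : ℕ) :
    (ψ ^ n).comp f = f.comp (φ ^ n) := by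
  induction n with
  | zero => rfl
  | succ n ih =>
    rw [pow_succ', pow_succ, RingHom.mul_def, RingHom.mul_def, RingHom.comp_assoc, ih,
      ← RingHom.comp_assoc, hcomm, RingHom.comp_assoc, ← RingHom.mul_def, ← pow_succ', pow_succ,
      RingHom.mul_def]

variable [IsNoetherianRing R] [IsNoetherianRing S]

omit [IsNoetherianRing S] in
theorem length_pow_le_mul (hφ : IsFiniteLengthHom φ) (hcomm : ψ.comp f = f.comp φ) (n : ℕ) :
    Module.length S (S ⧸ (maximalIdeal S).map (ψ ^ n)) ≤
      Module.length R (R ⧸ (maximalIdeal R).map (φ ^ n)) *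
        Module.length S (S ⧸ ((maximalIdeal R).map f ⊔ (maximalIdeal S).map (ψ ^ n))) := by
  obtain ⟨N, hN⟩ := exists_maximalIdeal_pow_le (hφ.le_radical_map_pow Ideal.le_radical n)
  have h := length_quotient_map_sup_le f ((maximalIdeal S).map (ψ ^ n)) hN
  rwa [Ideal.map_map, ← pow_comp_eq_comp_pow hcomm, ← Ideal.map_map,
    sup_eq_right.mpr (Ideal.map_mono (map_maximalIdeal_le f))] at h

theorem exists_mul_le_mul_length_pow (hφ : IsFiniteLengthHom φ) (hψ : IsFiniteLengthHom ψ)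
    (hcomm : ψ.comp f = f.comp φ) (hf : f.Flat) (hS : IsCohenMacaulay S) :
    ∃ C : ℕ∞, C ≠ ⊤ ∧ ∀ n, Module.length R (R ⧸ (maximalIdeal R).map (φ ^ n)) *
        Module.length S (S ⧸ ((maximalIdeal R).map f ⊔ (maximalIdeal S).map (ψ ^ n))) ≤
      C * Module.length S (S ⧸ (maximalIdeal S).map (ψ ^ n)) := by
  obtain ⟨x, y, hxm, hym, hx, hy, hdim⟩ := exists_parameters_of_flat hf
  -- The constant is ℓ(S/(x, y)S).
  refine ⟨_, length_quotient_ne_top_of_le_radical hy, fun n => ?_⟩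
  have hxle : Ideal.ofList x ≤ maximalIdeal R := Ideal.span_le.mpr hxm
  have hyle : Ideal.ofList y ≤ maximalIdeal S := Ideal.span_le.mpr hym
  have hmap : ((Ideal.ofList x).map f ⊔ Ideal.ofList y).map (ψ ^ n) =
      ((Ideal.ofList x).map (φ ^ n)).map f ⊔ Ideal.ofList (y.map (ψ ^ n)) := by
    rw [Ideal.map_sup, Ideal.map_map, pow_comp_eq_comp_pow hcomm, ← Ideal.map_map,
      Ideal.map_ofList _ y]
  have hlist : Ideal.ofList ((x.map (φ ^ n)).map f) = ((Ideal.ofList x).map (φ ^ n)).map f := by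
    rw [Ideal.map_ofList, Ideal.map_ofList]
  have hreg : RegularOn ⊥ ((x.map (φ ^ n)).map f ++ y.map (ψ ^ n)) := by
    refine hS.regularOn ?_ (fun a ha => ?_) ?_
    · rw [← hdim]
      simp
    · have ha : a ∈ Ideal.ofList ((x.map (φ ^ n)).map f ++ y.map (ψ ^ n)) := Ideal.subset_span ha
      rw [Ideal.ofList_append, hlist, ← hmap] at ha
      refine (?_ : _ ≤ maximalIdeal S) ha
      exact hψ.map_pow_le (sup_le ((Ideal.map_mono hxle).trans (map_maximalIdeal_le f)) hyle) n
    · rw [Ideal.ofList_append, hlist, ← hmap]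
      exact hψ.le_radical_map_pow hy n
  have hreg := hreg.of_append
  rw [bot_sup_eq, hlist] at hreg
  obtain ⟨N, hN⟩ := exists_maximalIdeal_pow_le (hφ.le_radical_map_pow hx n)
  -- Replacing 𝔪 by (x) and 𝔫 by (y) only increases the two lengths.
  calc _ ≤ Module.length R (R ⧸ (Ideal.ofList x).map (φ ^ n)) * Module.length S
          (S ⧸ ((maximalIdeal R).map f ⊔ Ideal.ofList (y.map (ψ ^ n)))) := by
        refine mul_le_mul' (length_quotient_anti (Ideal.map_mono hxle)) (length_quotient_anti ?_)
        rw [← Ideal.map_ofList]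
        exact sup_le_sup_left (Ideal.map_mono hyle) _
    _ ≤ Module.length S (S ⧸ ((Ideal.ofList x).map f ⊔ Ideal.ofList y).map (ψ ^ n)) := by
        rw [hmap]
        exact le_length_quotient_of_flat hf hN hreg
    _ ≤ _ := length_quotient_map_le (ψ ^ n) hy

theorem localEntropy_eq_add (hφ : IsFiniteLengthHom φ) (hψ : IsFiniteLengthHom ψ)
    (hcomm : ψ.comp f = f.comp φ) (hf : f.Flat) (hS : IsCohenMacaulay S) :
    localEntropy ψ = localEntropy φ + localEntropy (inducedEnd hφ.isLocalHom hcomm) := by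
  have hbar := isFiniteLengthHom_inducedEnd hφ.isLocalHom hcomm hψ
  obtain ⟨C, hC, hge⟩ := exists_mul_le_mul_length_pow hφ hψ hcomm hf hS
  refine limit_eq_add_of_le_mul (C := C.toNat) hφ.length_toNat_pos hbar.length_toNat_pos
    hψ.length_toNat_pos (fun n => ?_) (fun n => ?_) hφ.tendsto_entropySeq hbar.tendsto_entropySeq
    hψ.tendsto_entropySeq
  · rw [← ENat.toNat_mul]
    refine ENat.toNat_le_toNat ?_ (WithTop.mul_ne_top (hφ.length_ne_top n) (hbar.length_ne_top n))
    rw [length_inducedEnd_pow]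
    exact length_pow_le_mul hφ hcomm n
  · rw [← ENat.toNat_mul, ← ENat.toNat_mul]
    refine ENat.toNat_le_toNat ?_ (WithTop.mul_ne_top hC (hψ.length_ne_top n))
    rw [length_inducedEnd_pow]
    exact hge n

end InducedEnd

end

end LocalDyn

theorem theorem1 {R : Type u} {S : Type v}
    [CommRing R] [IsLocalRing R] [IsNoetherianRing R]
    [CommRing S] [IsLocalRing S] [IsNoetherianRing S]
    (φ : R →+* R) (ψ : S →+* S)
    (hφ : LocalDyn.IsFiniteLengthHom φ) (hψ : LocalDyn.IsFiniteLengthHom ψ)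
    (f : R →+* S) [IsLocalHom f] (hcomm : ψ.comp f = f.comp φ)
    (hflat : f.Flat) (hCM : LocalDyn.IsCohenMacaulay S) :
    LocalDyn.IsFiniteLengthHom (LocalDyn.inducedEnd hφ.isLocalHom hcomm) ∧
    Tendsto (LocalDyn.entropySeq φ) atTop (𝓝 (LocalDyn.localEntropy φ)) ∧
    Tendsto (LocalDyn.entropySeq ψ) atTop (𝓝 (LocalDyn.localEntropy ψ)) ∧
    Tendsto (LocalDyn.entropySeq (LocalDyn.inducedEnd hφ.isLocalHom hcomm)) atTop
      (𝓝 (LocalDyn.localEntropy (LocalDyn.inducedEnd hφ.isLocalHom hcomm))) ∧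
    LocalDyn.localEntropy ψ =
      LocalDyn.localEntropy φ +
        LocalDyn.localEntropy (LocalDyn.inducedEnd hφ.isLocalHom hcomm) := by
  have hbar := LocalDyn.isFiniteLengthHom_inducedEnd hφ.isLocalHom hcomm hψ
  exact ⟨hbar, hφ.tendsto_entropySeq, hψ.tendsto_entropySeq, hbar.tendsto_entropySeq,
    LocalDyn.localEntropy_eq_add hφ hψ hcomm hflat hCM⟩
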